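/- Let $n\ge 1$ and $0<r_1<\dots<r_\ell\le n$. Let $X_r$ be the graph on $\{0,1\}^n$ in which two distinct sequences are adjacent iff their Hamming distance is $r$, and let $X=X_{r_1}\cup\dots\cup X_{r_\ell}$; suppose $X\ne X_n$. Let $U(t)=e^{-\mathrm{i}tA(X)}$, where $A(X)$ is the adjacency matrix. For real $\zeta,\alpha$ and complex $\beta\ne0$ with $|\alpha|^2+|\beta|^2=1$, and for $\tau>0$, say that $X$ has $e^{\mathrm{i}\zeta}(\alpha,\beta)$-revival at time $\tau$ if for every vertex $a$ there is a vertex $b\ne a$ with $U(\tau)\mathbf e_a=e^{\mathrm{i}\zeta}(\alpha\,\mathbf e_a+\beta\,\mathbf e_b)$. Let $k\ge 0$ be an integer, $\zeta\in\mathbb R$ and $\varepsilon\in\{1,-1\}$. Here $\binom ab=0$ unless $0\le b\le a$, and for rational or real numbers $x\equiv y \pmod m$ means that $(x-y)/m$ is an integer. Then $X$ has $e^{\mathrm{i}\zeta}\left(\cos\frac\pi4,\ \varepsilon\,\mathrm{i}\sin\frac\pi4\right)$-revival at time $\pi/2^k$ if and only if the following three conditions hold: (i) $\displaystyle\sum_{i=1}^{\ell}\binom{n-1}{r_i-1}\equiv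 -\varepsilon\,2^{k-2}\pmod{2^k}$; (ii) $\displaystyle\sum_{i=1}^{\ell}\binom{n-1-j}{r_i-j}\equiv 0\pmod{2^{k-j}}$ for all $j=1,\dots,k-1$; (iii) $\displaystyle\zeta+\frac{\pi}{2^k}\sum_{i=1}^{\ell}\binom{n}{r_i}\equiv -\varepsilon\,\frac{\pi}{4}\pmod{2\pi}$. -/

import Mathlib

/-- The distance-`r` graph `X_r` of the binary Hamming scheme `H(n,2)`: the vertices are the binary
sequences of length `n`, and two distinct vertices are adjacent when their Hamming distance
is `r`. -/
def hammingGraph (n r : ℕ) : SimpleGraph (Fin n → Bool) where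
  Adj x y := x ≠ y ∧ hammingDist x y = r
  symm := ⟨fun x y h => ⟨h.1.symm, by rw [hammingDist_comm]; exact h.2⟩⟩
  loopless := ⟨fun _ h => h.1 rfl⟩

/-- The union of the distance graphs `X_r`, `r ∈ R`. -/
def hammingUnion (n : ℕ) (R : Finset ℕ) : SimpleGraph (Fin n → Bool) :=
  ⨆ r ∈ R, hammingGraph n r

section Revival

variable {V : Type*} [Fintype V] [DecidableEq V]

open Classical in
/-- The transition matrix `U(t) = exp(-i t A(X))` of the continuous-time quantum walk on `X`. -/
noncomputable def transitionMatrix (X : SimpleGraph V) (t : ℝ) : Matrix V V ℂ :=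
  NormedSpace.exp ((-(Complex.I * (t : ℂ))) • X.adjMatrix ℂ)

/-- `(α, β)`-revival occurs in `X` from `a` to `b` at time `τ`. -/
def HasRevivalFromTo (X : SimpleGraph V) (α β : ℂ) (τ : ℝ) (a b : V) : Prop :=
  a ≠ b ∧ 0 < τ ∧ β ≠ 0 ∧ ‖α‖ ^ 2 + ‖β‖ ^ 2 = 1 ∧
    (transitionMatrix X τ).mulVec (Pi.single a 1) =
      α • (Pi.single a 1 : V → ℂ) + β • (Pi.single b 1 : V → ℂ)

/-- `X` has `(α, β)`-revival at time `τ`: it occurs from every vertex at this time. -/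
def HasRevival (X : SimpleGraph V) (α β : ℂ) (τ : ℝ) : Prop :=
  ∀ a, ∃ b, HasRevivalFromTo X α β τ a b

/-- `X` has `e^{iζ}(α, β)`-revival at time `τ`, with `ζ` and `α` real and `β` complex. -/
def HasPhasedRevival (X : SimpleGraph V) (ζ α : ℝ) (β : ℂ) (τ : ℝ) : Prop :=
  HasRevival X (Complex.exp (Complex.I * (ζ : ℂ)) * (α : ℂ))
    (Complex.exp (Complex.I * (ζ : ℂ)) * β) τ

end Revival

/-- The binomial coefficient of two integers, equal to `0` unless `0 ≤ b ≤ a`. -/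
def intBinom (a b : ℤ) : ℤ :=
  if 0 ≤ b ∧ b ≤ a then (a.toNat.choose b.toNat : ℤ) else 0

/-! The characters of (ℤ/2)^n diagonalise the graph, with an eigenvalue θ_s depending only on the
weight s. Equality of the weight-one eigenvalues forces the partner of the zero sequence to be its
complement (`hasRevival_hammingUnion_iff`). Revival thus means exp(-iπθ_s/2^k) = e^{iζ} exp(iε(-1)^s
π/4) for all s ≤ n, which says that n + 1 real numbers are integers (`phase_eq_iff`).

These numbers are the binomial transform of d_m = (-2)^m (c_m/2^k + ε/4)/2, plus ζ/2π at m = 0,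
where c_m = Σ_r binom(n-m, r-m). The transform is integral and unitriangular, so the condition is
that every d_m is an integer. Here d_0 gives (iii) and d_1 gives (i); given (i), Pascal's rule turns
the remaining ones into (ii) (`dvd_alternating_iff`). -/

open Polynomial

/-! ### Eigenvalues as a binomial transform -/

theorem int_binomial_transform_iff (n : ℕ) (d : ℕ → ℝ) :
    (∀ s ≤ n, ∃ z : ℤ, ∑ m ∈ Finset.range (s + 1), (s.choose m : ℝ) * d m = z) ↔
      ∀ m ≤ n, ∃ z : ℤ, d m = z := by
  constructor
  · intro h m
    induction m using Nat.strong_induction_on with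
    | _ m ih =>
      intro hm
      obtain ⟨z, hz⟩ := h m hm
      choose! w hw using fun i (hi : i < m) => ih i hi (by omega)
      rw [Finset.sum_range_succ, Nat.choose_self, Nat.cast_one, one_mul] at hz
      refine ⟨z - ∑ i ∈ Finset.range m, (m.choose i : ℤ) * w i, ?_⟩
      rw [Finset.sum_congr rfl fun i hi => by rw [hw i (Finset.mem_range.1 hi)]] at hz
      push_cast
      linarith
  · intro h s hs
    choose! w hw using h
    refine ⟨∑ i ∈ Finset.range (s + 1), (s.choose i : ℤ) * w i, ?_⟩
    push_cast
    exact Finset.sum_congr rfl fun i hi => by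
      rw [hw i (by have := Finset.mem_range.1 hi; omega)]

/-- The eigenvalue of the union of the distance graphs `X_r`, `r ∈ R`, at a character of
weight `s`. -/
noncomputable def hammingEigenvalue (n : ℕ) (R : Finset ℕ) (s : ℕ) : ℤ :=
  ∑ r ∈ R, ((1 - X : ℤ[X]) ^ s * (1 + X) ^ (n - s)).coeff r

theorem coeff_X_pow_mul_one_add_X_pow (n m r : ℕ) (hm : m ≤ n) :
    (X ^ m * (1 + X) ^ (n - m) : ℤ[X]).coeff r = intBinom (n - m) (r - m) := by
  rw [coeff_X_pow_mul', coeff_one_add_X_pow, intBinom]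
  split_ifs with h1 h2 h2
  · congr 2 <;> omega
  · exact_mod_cast Nat.choose_eq_zero_of_lt (by omega)
  · omega
  · rfl

theorem hammingEigenvalue_eq_sum (n : ℕ) (R : Finset ℕ) (s : ℕ) (hs : s ≤ n) :
    hammingEigenvalue n R s = ∑ m ∈ Finset.range (s + 1),
      (s.choose m : ℤ) * ((-2) ^ m * ∑ r ∈ R, intBinom (n - m) (r - m)) := by
  have key : (1 - X : ℤ[X]) ^ s * (1 + X) ^ (n - s) = ∑ m ∈ Finset.range (s + 1),
      C ((s.choose m : ℤ) * (-2) ^ m) * (X ^ m * (1 + X) ^ (n - m)) := by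
    -- This splitting makes the power of 2 in each term explicit.
    have h : (1 - X : ℤ[X]) = C (-2) * X + (1 + X) := by
      simp only [map_neg, map_ofNat]; ring
    rw [h, add_pow, Finset.sum_mul]
    refine Finset.sum_congr rfl fun m hm => ?_
    have hm := Finset.mem_range.1 hm
    rw [show n - m = (s - m) + (n - s) by omega, pow_add, mul_pow]
    simp only [map_mul, map_pow, map_natCast]
    ring
  unfold hammingEigenvalue
  simp only [key, finsetSum_coeff, coeff_C_mul]
  rw [Finset.sum_comm]
  refine Finset.sum_congr rfl fun m hm => ?_
  have hm := Finset.mem_range.1 hm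
  rw [Finset.mul_sum, Finset.mul_sum]
  refine Finset.sum_congr rfl fun r _ => ?_
  rw [coeff_X_pow_mul_one_add_X_pow n m r (by omega)]
  ring

theorem intBinom_pascal (a b : ℤ) (ha : 0 ≤ a) :
    intBinom (a + 1) b = intBinom a b + intBinom a (b - 1) := by
  obtain ⟨a, rfl⟩ := Int.eq_ofNat_of_zero_le ha
  unfold intBinom
  rcases lt_trichotomy b 0 with hb | rfl | hb
  · rw [if_neg (by omega), if_neg (by omega), if_neg (by omega)]; rfl
  · rw [if_pos (by omega), if_pos (by omega), if_neg (by omega)]; simp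
  · obtain ⟨c, rfl⟩ : ∃ c : ℕ, b = c + 1 := ⟨(b - 1).toNat, by omega⟩
    have e : ∀ x y : ℕ, (if (0 : ℤ) ≤ y ∧ (y : ℤ) ≤ x then ((x : ℤ).toNat.choose (y : ℤ).toNat : ℤ)
        else 0) = x.choose y := by
      intro x y
      split_ifs with h
      · rfl
      · exact_mod_cast (Nat.choose_eq_zero_of_lt (by omega)).symm
    have h1 := e (a + 1) (c + 1)
    have h2 := e a (c + 1)
    have h3 := e a c
    push_cast at h1 h2 h3
    rw [add_sub_cancel_right]
    rw [h1, h2, h3, Nat.choose_succ_succ]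
    push_cast
    ring

/-! ### From phases to congruences -/

theorem phase_eq_iff (k : ℕ) (ζ : ℝ) (ε : ℤ) (hε : ε = 1 ∨ ε = -1) (s : ℕ) (θ : ℤ) :
    Complex.exp (-(Complex.I * ((Real.pi / 2 ^ k : ℝ) : ℂ)) * θ) =
        Complex.exp (Complex.I * (ζ : ℂ)) * ((Real.cos (Real.pi / 4) : ℝ) : ℂ) +
        Complex.exp (Complex.I * (ζ : ℂ)) *
          ((ε : ℂ) * (Complex.I * (Real.sin (Real.pi / 4) : ℂ))) * (-1) ^ s ↔
      ∃ z : ℤ, ((θ : ℝ) / 2 ^ k + ε * (-1) ^ s / 4) / 2 + ζ / (2 * Real.pi) = z := by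
  have hpi := Real.pi_pos.ne'
  have h : Complex.exp (Complex.I * (ζ : ℂ)) * ((Real.cos (Real.pi / 4) : ℝ) : ℂ) +
        Complex.exp (Complex.I * (ζ : ℂ)) *
          ((ε : ℂ) * (Complex.I * (Real.sin (Real.pi / 4) : ℂ))) * (-1) ^ s =
      Complex.exp (Complex.I * ((ζ + ε * (-1) ^ s * (Real.pi / 4) : ℝ) : ℂ)) := by
    -- Since ε(-1)^s is ±1, it passes through the even cosine and the odd sine.
    have e : Complex.exp (((ε * (-1) ^ s * (Real.pi / 4) : ℝ) : ℂ) * Complex.I) =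
        ((Real.cos (Real.pi / 4) : ℝ) : ℂ) +
          ((ε : ℂ) * (Complex.I * (Real.sin (Real.pi / 4) : ℂ))) * (-1) ^ s := by
      rw [Complex.exp_mul_I, ← Complex.ofReal_cos, ← Complex.ofReal_sin]
      rcases hε with rfl | rfl <;> rcases neg_one_pow_eq_or ℝ s with hs | hs <;>
        have hs' : ((-1 : ℂ)) ^ s = (((-1 : ℝ) ^ s : ℝ) : ℂ) := by { push_cast; rfl }
      all_goals rw [hs', hs]; simp [Real.cos_neg, Real.sin_neg]; try ring
    push_cast at e ⊢
    rw [mul_add, Complex.exp_add, mul_comm Complex.I (_ * _ * _), e]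
    ring
  rw [h, Complex.exp_eq_exp_iff_exists_int]
  constructor
  · rintro ⟨z, hz⟩
    refine ⟨-z, ?_⟩
    have hz' : -(Real.pi / 2 ^ k * θ) = ζ + ε * (-1) ^ s * (Real.pi / 4) + z * (2 * Real.pi) := by
      have := congrArg Complex.im hz
      rw [show (z : ℂ) = ((z : ℝ) : ℂ) by push_cast; rfl,
        show (θ : ℂ) = ((θ : ℝ) : ℂ) by push_cast; rfl] at this
      simpa [← Complex.ofReal_mul, -Complex.ofReal_div, -Complex.ofReal_intCast] using this
    push_cast
    have : ((θ : ℝ) / 2 ^ k + ε * (-1) ^ s / 4) / 2 + ζ / (2 * Real.pi) =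
        (Real.pi / 2 ^ k * θ + ζ + ε * (-1) ^ s * (Real.pi / 4)) / (2 * Real.pi) := by
      field_simp
      ring
    rw [this, div_eq_iff (by positivity)]
    linarith
  · rintro ⟨z, hz⟩
    refine ⟨-z, ?_⟩
    have hz' : -(Real.pi / 2 ^ k * θ) = ζ + ε * (-1) ^ s * (Real.pi / 4) - z * (2 * Real.pi) := by
      rw [← hz]
      field_simp
      ring
    have := congrArg (fun x : ℝ => (x : ℂ) * Complex.I) hz'
    push_cast at this ⊢
    linear_combination this

theorem neg_one_pow_eq_sum_choose (s : ℕ) :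
    (-1 : ℝ) ^ s = ∑ m ∈ Finset.range (s + 1), (s.choose m : ℝ) * (-2) ^ m := by
  rw [show (-1 : ℝ) = -2 + 1 by norm_num, add_pow]
  exact Finset.sum_congr rfl fun m _ => by rw [one_pow, mul_one, mul_comm]

/-- (-1)^s is the transform of (-2)^m, and the constant ζ/2π that of a sequence supported at m = 0.
-/
theorem phases_iff_coefficients (n : ℕ) (R : Finset ℕ) (k : ℕ) (ζ : ℝ) (ε : ℤ) :
    (∀ s ≤ n, ∃ z : ℤ, ((hammingEigenvalue n R s : ℝ) / 2 ^ k + ε * (-1) ^ s / 4) / 2 +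
        ζ / (2 * Real.pi) = z) ↔
      ∀ m ≤ n, ∃ z : ℤ, (-2 : ℝ) ^ m *
        (((∑ r ∈ R, intBinom (n - m) (r - m) : ℤ) : ℝ) / 2 ^ k + ε / 4) / 2 +
          (if m = 0 then ζ / (2 * Real.pi) else 0) = z := by
  refine Iff.trans ?_ (int_binomial_transform_iff n _)
  refine forall₂_congr fun s hs => ?_
  rw [hammingEigenvalue_eq_sum n R s hs, neg_one_pow_eq_sum_choose]
  refine exists_congr fun z => ?_
  simp only [mul_add _ _ (ite _ _ _), Finset.sum_add_distrib, mul_ite, mul_zero,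
    Finset.sum_ite_eq', Finset.mem_range, Nat.succ_pos, if_true, Nat.choose_zero_right,
    Nat.cast_one, one_mul]
  refine iff_of_eq (congrArg (· = _) (congrArg (· + _) ?_))
  generalize hc : (fun m : ℕ => ∑ r ∈ R, intBinom (n - m) (r - m)) = c
  simp only [fun m : ℕ => show ∑ r ∈ R, intBinom (n - m) (r - m) = c m from congrFun hc m]
  push_cast
  rw [Finset.mul_sum, Finset.sum_div, Finset.sum_div, ← Finset.sum_add_distrib, Finset.sum_div]
  exact Finset.sum_congr rfl fun m _ => by ring

/-- S j is the difference of consecutive terms c j + q, and the required power of 2 drops by one per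
step, so divisibility telescopes from `h1`. Indices j ≥ n are harmless because S vanishes there. -/
theorem dvd_alternating_iff (n k : ℕ) (c S : ℕ → ℤ) (q : ℤ) (hk : 1 ≤ k)
    (hpas : ∀ j, 1 ≤ j → j < n → c j = S j + c (j + 1)) (hS : ∀ j, n ≤ j → S j = 0)
    (h1 : (2 : ℤ) ^ k ∣ c 1 + q) :
    (∀ j, j < n → j < k → (2 : ℤ) ^ (k - j) ∣ c (j + 1) + q) ↔
      ∀ j, 1 ≤ j → j ≤ k - 1 → (2 : ℤ) ^ (k - j) ∣ S j := by
  constructor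
  · intro h j hj hjk
    rcases le_or_gt n j with hn | hn
    · simp [hS j hn]
    · have e : S j = (c j + q) - (c (j + 1) + q) := by rw [hpas j hj hn]; ring
      rw [e]
      refine dvd_sub ?_ (h j hn (by omega))
      obtain ⟨i, rfl⟩ : ∃ i, j = i + 1 := ⟨j - 1, by omega⟩
      exact (pow_dvd_pow 2 (by omega)).trans (h i (by omega) (by omega))
  · intro h j
    induction j with
    | zero => intro _ _; simpa using h1
    | succ i ih =>
      intro hn hk
      have e : c (i + 1 + 1) + q = (c (i + 1) + q) - S (i + 1) := by
        rw [hpas (i + 1) (by omega) hn]; ring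
      rw [e]
      exact dvd_sub ((pow_dvd_pow 2 (by omega)).trans (ih (by omega) (by omega)))
        (h (i + 1) (by omega) (by omega))

theorem constant_coefficient_iff (k : ℕ) (ζ : ℝ) (ε c : ℤ) :
    (∃ z : ℤ, ((c : ℝ) / 2 ^ k + ε / 4) / 2 + ζ / (2 * Real.pi) = z) ↔
      ζ + (c : ℝ) * Real.pi / 2 ^ k ≡ -(ε : ℝ) * (Real.pi / 4) [PMOD (2 * Real.pi)] := by
  have hpi := Real.pi_pos.ne'
  rw [AddCommGroup.modEq_comm, AddCommGroup.modEq_iff_zsmul']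
  refine exists_congr fun z => ?_
  have : ((c : ℝ) / 2 ^ k + ε / 4) / 2 + ζ / (2 * Real.pi) =
      (ζ + c * Real.pi / 2 ^ k - -(ε : ℝ) * (Real.pi / 4)) / (2 * Real.pi) := by
    field_simp
    ring
  rw [this, div_eq_iff (by positivity), zsmul_eq_mul]

theorem linear_coefficient_iff (k : ℕ) (ε c : ℤ) :
    (∃ z : ℤ, (-2 : ℝ) ^ 1 * ((c : ℝ) / 2 ^ k + ε / 4) / 2 = z) ↔
      (c : ℚ) ≡ -(ε : ℚ) * (2 : ℚ) ^ ((k : ℤ) - 2) [PMOD ((2 : ℚ) ^ k)] := by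
  rw [AddCommGroup.modEq_iff_zsmul']
  refine exists_congr fun z => ?_
  rw [zpow_sub₀ two_ne_zero, zpow_natCast, zsmul_eq_mul]
  rw [← Rat.cast_inj (α := ℝ)]
  push_cast
  have h : (2 : ℝ) ^ k ≠ 0 := by positivity
  constructor <;> intro e
  · rw [← e]; field_simp; norm_num; ring
  · field_simp at e ⊢; norm_num at e ⊢; linarith

/-- Clearing denominators gives 4 ∣ ε 2^k. Hence 2^(k-2) is an integer in the later divisibilities.
-/
theorem two_le_of_modEq (k : ℕ) (ε c : ℤ) (hε : ε = 1 ∨ ε = -1)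
    (h : (c : ℚ) ≡ -(ε : ℚ) * (2 : ℚ) ^ ((k : ℤ) - 2) [PMOD ((2 : ℚ) ^ k)]) : 2 ≤ k := by
  rw [AddCommGroup.modEq_iff_zsmul'] at h
  obtain ⟨z, hz⟩ := h
  rw [zpow_sub₀ two_ne_zero, zpow_natCast, zsmul_eq_mul] at hz
  have hz' : -ε * 2 ^ k - 4 * c = 4 * (z * 2 ^ k) := by
    have : (-(ε : ℚ) * 2 ^ k - 4 * c) = 4 * (z * 2 ^ k) := by
      rw [← hz]; norm_num; ring
    exact_mod_cast this
  by_contra! hk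
  interval_cases k <;> omega

/-- The number is ±2^j (c + ε 2^(k-2)) / 2^k, automatically an integer once j ≥ k. -/
theorem higher_coefficient_iff (k j : ℕ) (hk : 2 ≤ k) (ε c : ℤ) :
    (∃ z : ℤ, (-2 : ℝ) ^ (j + 1) * ((c : ℝ) / 2 ^ k + ε / 4) / 2 = z) ↔
      (j < k → (2 : ℤ) ^ (k - j) ∣ c + ε * 2 ^ (k - 2)) := by
  obtain ⟨l, rfl⟩ := Nat.exists_eq_add_of_le' hk
  rw [Nat.add_sub_cancel]
  have key : (-2 : ℝ) ^ (j + 1) * ((c : ℝ) / 2 ^ (l + 2) + ε / 4) / 2 =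
      (-1) ^ (j + 1) * 2 ^ j * (c + ε * 2 ^ l) / 2 ^ (l + 2) := by
    rw [neg_pow, pow_succ (2 : ℝ) j]
    field_simp
    ring
  have h2 : ((2 : ℝ) ^ (l + 2)) ≠ 0 := by positivity
  have step : (∃ z : ℤ, (-2 : ℝ) ^ (j + 1) * ((c : ℝ) / 2 ^ (l + 2) + ε / 4) / 2 = z) ↔
      (2 : ℤ) ^ (l + 2) ∣ 2 ^ j * (c + ε * 2 ^ l) := by
    rw [key]
    have : (2 : ℤ) ^ (l + 2) ∣ 2 ^ j * (c + ε * 2 ^ l) ↔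
        (2 : ℤ) ^ (l + 2) ∣ (-1) ^ (j + 1) * 2 ^ j * (c + ε * 2 ^ l) := by
      rcases neg_one_pow_eq_or ℤ (j + 1) with h | h <;> rw [h] <;> simp
    rw [this]
    refine exists_congr fun z => ?_
    rw [div_eq_iff h2, mul_comm (z : ℝ)]
    norm_cast
  rw [step]
  rcases lt_or_ge j (l + 2) with hj | hj
  · simp only [hj, true_imp_iff]
    have : (2 : ℤ) ^ (l + 2) = 2 ^ j * 2 ^ (l + 2 - j) := by rw [← pow_add]; congr 1; omega
    rw [this, mul_dvd_mul_iff_left (by positivity)]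
  · exact iff_of_true ((pow_dvd_pow 2 hj).mul_right _) fun h => absurd h (by omega)

theorem phases_iff_congruences (n : ℕ) (hn : 0 < n) (R : Finset ℕ) (k : ℕ) (ζ : ℝ) (ε : ℤ)
    (hε : ε = 1 ∨ ε = -1) :
    (∀ s ≤ n, ∃ z : ℤ, ((hammingEigenvalue n R s : ℝ) / 2 ^ k + ε * (-1) ^ s / 4) / 2 +
        ζ / (2 * Real.pi) = z) ↔
      (((∑ r ∈ R, intBinom (n - 1) (r - 1) : ℤ) : ℚ)
          ≡ -(ε : ℚ) * (2 : ℚ) ^ ((k : ℤ) - 2) [PMOD ((2 : ℚ) ^ k)]) ∧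
      (∀ j : ℕ, 1 ≤ j → j ≤ k - 1 →
        ∑ r ∈ R, intBinom (n - 1 - j) (r - j) ≡ 0 [ZMOD 2 ^ (k - j)]) ∧
      (ζ + ((∑ r ∈ R, intBinom n r : ℤ) : ℝ) * Real.pi / 2 ^ k
          ≡ -(ε : ℝ) * (Real.pi / 4) [PMOD (2 * Real.pi)]) := by
  rw [phases_iff_coefficients, ← constant_coefficient_iff]
  set c : ℕ → ℤ := fun m => ∑ r ∈ R, intBinom (n - m) (r - m) with hc
  set S : ℕ → ℤ := fun j => ∑ r ∈ R, intBinom (n - 1 - j) (r - j) with hSdef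
  have c0 : ∑ r ∈ R, intBinom n r = c 0 := by simp [hc]
  have c1 : ∑ r ∈ R, intBinom (n - 1) (r - 1) = c 1 := by simp [hc]
  rw [c0, c1, ← linear_coefficient_iff]
  have hpas : ∀ j, 1 ≤ j → j < n → c j = S j + c (j + 1) := by
    intro j _ hjn
    simp only [hc, hSdef, ← Finset.sum_add_distrib]
    refine Finset.sum_congr rfl fun r _ => ?_
    rw [show (n : ℤ) - j = (n - 1 - j) + 1 by ring, intBinom_pascal _ _ (by omega)]
    congr 2 <;> push_cast <;> ring
  have hS : ∀ j, n ≤ j → S j = 0 := fun j hj =>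
    Finset.sum_eq_zero fun r _ => if_neg (by omega)
  -- P 1 is repeated so that (i) is available when the other coefficients are rewritten.
  have split : ∀ P : ℕ → Prop, (∀ m ≤ n, P m) ↔ P 1 ∧ (∀ j < n, P (j + 1)) ∧ P 0 := by
    refine fun P => ⟨fun h => ⟨h 1 hn, fun j hj => h (j + 1) hj, h 0 n.zero_le⟩, ?_⟩
    rintro ⟨-, h, h0⟩ (_ | m) hm
    exacts [h0, h m hm]
  rw [split]
  simp only [if_true, Nat.succ_ne_zero, one_ne_zero, if_false, add_zero, pow_zero, one_mul,
    Int.modEq_zero_iff_dvd]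
  refine and_congr_right fun h1 => and_congr_left fun _ => ?_
  have hk := two_le_of_modEq k ε _ hε ((linear_coefficient_iff _ _ _).1 h1)
  have h1' := (higher_coefficient_iff k 0 hk ε (c 1)).1 (by rw [zero_add]; exact h1) (by omega)
  rw [← dvd_alternating_iff n k c S _ (by omega) hpas hS (by simpa using h1')]
  exact forall₂_congr fun j _ => higher_coefficient_iff k j hk ε _

/-! ### Diagonalisation by characters -/

/-- The number of ones of a binary sequence. -/
def binaryWeight {n : ℕ} (x : Fin n → Bool) : ℕ := (Finset.univ.filter fun i => x i = true).card

/-- The character of `(ℤ/2)^n` attached to `y`, evaluated at `x`. -/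
def binaryChar {n : ℕ} (y x : Fin n → Bool) : ℤ := ∏ i, if y i && x i then -1 else 1

section

variable {n : ℕ}

theorem sum_prod_bool {A : Type*} [CommRing A] (f : Fin n → Bool → A) :
    ∑ z : Fin n → Bool, ∏ i, f i (z i) = ∏ i, (f i true + f i false) := by
  have := Finset.prod_univ_sum (fun _ : Fin n => (Finset.univ : Finset Bool)) f
  rw [Fintype.piFinset_univ] at this
  rw [← this]
  simp

theorem prod_ite_eq_pow_binaryWeight {A : Type*} [CommRing A] (y : Fin n → Bool) (a b : A) :
    ∏ i, (if y i = true then a else b) = a ^ binaryWeight y * b ^ (n - binaryWeight y) := by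
  rw [Finset.prod_ite, Finset.prod_const, Finset.prod_const, Finset.filter_not,
    Finset.card_sdiff_of_subset (Finset.filter_subset _ _), Finset.card_univ, Fintype.card_fin]
  rfl

theorem binaryWeight_le (y : Fin n → Bool) : binaryWeight y ≤ n :=
  (Finset.card_le_univ _).trans_eq (Fintype.card_fin n)

theorem exists_binaryWeight_eq (s : ℕ) (hs : s ≤ n) : ∃ y : Fin n → Bool, binaryWeight y = s := by
  obtain ⟨t, -, ht⟩ := Finset.exists_subset_card_eq
    (s := (Finset.univ : Finset (Fin n))) (n := s) (by simpa using hs)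
  exact ⟨fun i => decide (i ∈ t), by simp [binaryWeight, ht]⟩

theorem binaryChar_xor (y x z : Fin n → Bool) :
    binaryChar y (fun i => xor (x i) (z i)) = binaryChar y x * binaryChar y z := by
  rw [binaryChar, binaryChar, binaryChar, ← Finset.prod_mul_distrib]
  refine Finset.prod_congr rfl fun i _ => ?_
  cases y i <;> cases x i <;> cases z i <;> rfl

theorem binaryChar_false (y : Fin n → Bool) : binaryChar y (fun _ => false) = 1 := by
  simp [binaryChar]

theorem binaryChar_true (y : Fin n → Bool) :
    binaryChar y (fun _ => true) = (-1) ^ binaryWeight y := by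
  simp [binaryChar, prod_ite_eq_pow_binaryWeight]

theorem binaryChar_not (y x : Fin n → Bool) :
    binaryChar y (fun i => !x i) = binaryChar y x * (-1) ^ binaryWeight y := by
  rw [← binaryChar_true, ← binaryChar_xor]
  simp

/-- The sum factors over coordinates, each contributing 1 - X or 1 + X. -/
theorem sum_binaryChar_mul_X_pow (y : Fin n → Bool) :
    ∑ z : Fin n → Bool, C (binaryChar y z) * X ^ binaryWeight z =
      (1 - X : ℤ[X]) ^ binaryWeight y * (1 + X) ^ (n - binaryWeight y) := by
  rw [← prod_ite_eq_pow_binaryWeight]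
  have h : ∀ z : Fin n → Bool, C (binaryChar y z) * (X : ℤ[X]) ^ binaryWeight z =
      ∏ i, (if y i && z i then -1 else 1) * (if z i = true then X else 1) := by
    intro z
    have hX := prod_ite_eq_pow_binaryWeight z (X : ℤ[X]) 1
    rw [one_pow, mul_one] at hX
    rw [Finset.prod_mul_distrib, hX, binaryChar, map_prod]
    congr 1
    exact Finset.prod_congr rfl fun i _ => by split_ifs <;> simp
  simp only [h]
  rw [sum_prod_bool fun i b => (if y i && b then -1 else 1) * (if b = true then (X : ℤ[X]) else 1)]
  refine Finset.prod_congr rfl fun i _ => ?_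
  cases y i <;> simp <;> ring

theorem sum_binaryChar_of_weight_mem (R : Finset ℕ) (y : Fin n → Bool) :
    ∑ z : Fin n → Bool, (if binaryWeight z ∈ R then binaryChar y z else 0) =
      hammingEigenvalue n R (binaryWeight y) := by
  rw [hammingEigenvalue, ← sum_binaryChar_mul_X_pow]
  simp only [finsetSum_coeff, coeff_C_mul, coeff_X_pow]
  rw [Finset.sum_comm]
  refine Finset.sum_congr rfl fun z _ => ?_
  simp

theorem sum_binaryChar_mul_binaryChar (y w : Fin n → Bool) :
    ∑ z : Fin n → Bool, binaryChar y z * binaryChar z w = if y = w then 2 ^ n else 0 := by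
  have h : ∀ z : Fin n → Bool, binaryChar y z * binaryChar z w =
      ∏ i, (if y i && z i then -1 else 1) * (if z i && w i then (-1 : ℤ) else 1) := fun z => by
    rw [Finset.prod_mul_distrib]; rfl
  simp only [h]
  rw [sum_prod_bool fun i b => (if y i && b then -1 else 1) * (if b && w i then (-1 : ℤ) else 1)]
  split_ifs with hyw
  · subst hyw
    rw [Finset.prod_congr rfl fun i _ => show _ = (2 : ℤ) by cases y i <;> rfl]
    simp
  · obtain ⟨i, hi⟩ := Function.ne_iff.1 hyw
    refine Finset.prod_eq_zero (Finset.mem_univ i) ?_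
    revert hi
    cases y i <;> cases w i <;> simp

variable (n) in
/-- The character table of `(ℤ/2)^n`. -/
def binaryCharMatrix : Matrix (Fin n → Bool) (Fin n → Bool) ℂ :=
  Matrix.of fun y x => (binaryChar y x : ℂ)

theorem binaryCharMatrix_mul_self :
    binaryCharMatrix n * binaryCharMatrix n = (2 ^ n : ℂ) • 1 := by
  ext y w
  rw [Matrix.mul_apply, Matrix.smul_apply, Matrix.one_apply]
  have := congrArg (Int.cast : ℤ → ℂ) (sum_binaryChar_mul_binaryChar y w)
  push_cast at this
  simpa [binaryCharMatrix] using this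

theorem isUnit_binaryCharMatrix : IsUnit (binaryCharMatrix n) := by
  refine (Matrix.isUnit_iff_isUnit_det _).2 (Matrix.isUnit_det_of_right_inverse
    (B := (2 ^ n : ℂ)⁻¹ • binaryCharMatrix n) ?_)
  rw [Matrix.mul_smul, binaryCharMatrix_mul_self, smul_smul, inv_mul_cancel₀ (pow_ne_zero _ two_ne_zero),
    one_smul]

theorem hammingUnion_adj (R : Finset ℕ) (hR : ∀ r ∈ R, 0 < r) (x y : Fin n → Bool) :
    (hammingUnion n R).Adj x y ↔ hammingDist x y ∈ R := by
  simp only [hammingUnion, SimpleGraph.iSup_adj, hammingGraph]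
  constructor
  · rintro ⟨r, hr, -, rfl⟩
    exact hr
  · exact fun h => ⟨_, h, hammingDist_pos.1 (hR _ h), rfl⟩

theorem binaryCharMatrix_mul_adjMatrix (R : Finset ℕ) (hR : ∀ r ∈ R, 0 < r)
    [DecidableRel (hammingUnion n R).Adj] :
    binaryCharMatrix n * (hammingUnion n R).adjMatrix ℂ =
      Matrix.diagonal (fun y => (hammingEigenvalue n R (binaryWeight y) : ℂ)) *
        binaryCharMatrix n := by
  ext y a
  rw [Matrix.mul_apply, Matrix.diagonal_mul, ← sum_binaryChar_of_weight_mem]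
  -- Translation by a turns distance from a into weight.
  have inv : Function.Involutive fun (x : Fin n → Bool) i => xor (x i) (a i) :=
    fun x => by funext i; simp
  rw [← Equiv.sum_comp (inv.toPerm _)]
  simp only [binaryCharMatrix, Matrix.of_apply, SimpleGraph.adjMatrix_apply, hammingUnion_adj R hR]
  push_cast
  rw [Finset.sum_mul]
  refine Finset.sum_congr rfl fun z _ => ?_
  have h1 : hammingDist (inv.toPerm _ z) a = binaryWeight z := by
    refine congrArg Finset.card (Finset.filter_congr fun i _ => ?_)
    rw [Function.Involutive.coe_toPerm]
    cases z i <;> cases a i <;> simp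
  have h2 : binaryChar y (inv.toPerm _ z) = binaryChar y z * binaryChar y a :=
    binaryChar_xor y z a
  rw [h1, h2]
  split_ifs <;> simp

theorem binaryCharMatrix_mul_transitionMatrix (R : Finset ℕ) (hR : ∀ r ∈ R, 0 < r) (t : ℝ) :
    binaryCharMatrix n * transitionMatrix (hammingUnion n R) t =
      Matrix.diagonal (fun y => Complex.exp (-(Complex.I * (t : ℂ)) *
        hammingEigenvalue n R (binaryWeight y))) * binaryCharMatrix n := by
  classical
  have hdet := (Matrix.isUnit_iff_isUnit_det _).1 (isUnit_binaryCharMatrix (n := n))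
  unfold transitionMatrix
  set c : ℂ := -(Complex.I * (t : ℂ))
  have hconj := binaryCharMatrix_mul_adjMatrix (n := n) R hR
  have h : c • (hammingUnion n R).adjMatrix ℂ = (binaryCharMatrix n)⁻¹ *
      Matrix.diagonal (fun y => c * (hammingEigenvalue n R (binaryWeight y) : ℂ)) *
        binaryCharMatrix n := by
    have e : Matrix.diagonal (fun y => c * (hammingEigenvalue n R (binaryWeight y) : ℂ)) =
        c • Matrix.diagonal (fun y : Fin n → Bool =>
          (hammingEigenvalue n R (binaryWeight y) : ℂ)) := by
      rw [← Matrix.diagonal_smul]; rfl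
    rw [e, Matrix.mul_assoc, Matrix.smul_mul, ← hconj, Matrix.mul_smul,
      Matrix.nonsing_inv_mul_cancel_left _ _ hdet]
  have h' := congrArg NormedSpace.exp h
  rw [Matrix.exp_conj' _ _ isUnit_binaryCharMatrix, Matrix.exp_diagonal] at h'
  have h'' := congrArg (binaryCharMatrix n * ·) h'
  simp only [Matrix.mul_assoc, Matrix.mul_nonsing_inv_cancel_left _ _ hdet] at h''
  have e : NormedSpace.exp (fun y : Fin n → Bool =>
      c * (hammingEigenvalue n R (binaryWeight y) : ℂ)) =
      fun y => Complex.exp (c * hammingEigenvalue n R (binaryWeight y)) := by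
    funext y
    rw [Pi.coe_exp, Complex.exp_eq_exp_ℂ]
  rwa [e] at h''

theorem transitionMatrix_mulVec_single_eq_iff (R : Finset ℕ) (hR : ∀ r ∈ R, 0 < r) (t : ℝ)
    (α β : ℂ) (a b : Fin n → Bool) :
    (transitionMatrix (hammingUnion n R) t).mulVec (Pi.single a 1) =
        α • (Pi.single a 1 : (Fin n → Bool) → ℂ) + β • (Pi.single b 1 : (Fin n → Bool) → ℂ) ↔
      ∀ y : Fin n → Bool, Complex.exp (-(Complex.I * (t : ℂ)) *
          hammingEigenvalue n R (binaryWeight y)) * binaryChar y a =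
        α * binaryChar y a + β * binaryChar y b := by
  rw [← (Matrix.mulVec_injective_of_isUnit (isUnit_binaryCharMatrix (n := n))).eq_iff,
    Matrix.mulVec_mulVec, binaryCharMatrix_mul_transitionMatrix R hR, funext_iff]
  refine forall_congr' fun y => ?_
  rw [Matrix.mulVec_add, Matrix.mulVec_smul, Matrix.mulVec_smul]
  simp [Matrix.diagonal_mul, binaryCharMatrix]

/-! ### Revival in terms of eigenvalues -/

/-- The binary sequence whose only one is at `i`. -/
def binarySingle (i : Fin n) : Fin n → Bool := fun j => decide (j = i)

theorem binaryWeight_binarySingle (i : Fin n) : binaryWeight (binarySingle i) = 1 := by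
  simp [binaryWeight, binarySingle, Finset.filter_eq']

theorem binaryChar_binarySingle (i : Fin n) (x : Fin n → Bool) :
    binaryChar (binarySingle i) x = if x i then -1 else 1 := by
  rw [binaryChar, Finset.prod_eq_single i]
  · simp [binarySingle]
  · intro j _ hj
    simp [binarySingle, hj]
  · simp

theorem hasRevival_hammingUnion_iff (hn : 0 < n) (R : Finset ℕ) (hR : ∀ r ∈ R, 0 < r) (t : ℝ)
    (ht : 0 < t) (α β : ℂ) (hβ : β ≠ 0) (hαβ : ‖α‖ ^ 2 + ‖β‖ ^ 2 = 1) :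
    HasRevival (hammingUnion n R) α β t ↔ ∀ s ≤ n,
      Complex.exp (-(Complex.I * (t : ℂ)) * hammingEigenvalue n R s) = α + β * (-1) ^ s := by
  constructor
  · intro h s hs
    obtain ⟨b, hb, -, -, -, hU⟩ := h fun _ => false
    rw [transitionMatrix_mulVec_single_eq_iff R hR] at hU
    simp only [binaryChar_false, Int.cast_one, mul_one] at hU
    obtain ⟨i, hi⟩ : ∃ i, b i = true := by
      by_contra! hcon
      exact hb (funext fun i => (Bool.eq_false_iff.2 (hcon i)).symm)
    -- Weight-one characters share an eigenvalue, so as β ≠ 0 they agree at b: its entries are all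
    -- equal.
    have hb' : b = fun _ => true := by
      funext j
      by_contra hj
      have h1 := hU (binarySingle i)
      have h2 := hU (binarySingle j)
      rw [binaryWeight_binarySingle, binaryChar_binarySingle] at h1 h2
      rw [h1] at h2
      simp only [hi, hj, if_true, if_false] at h2
      push_cast at h2
      exact hβ (by linear_combination (-1 / 2 : ℂ) * h2)
    obtain ⟨y, rfl⟩ := exists_binaryWeight_eq s hs
    rw [hU y, hb', binaryChar_true]
    push_cast
    rfl
  · intro h a
    refine ⟨fun i => !a i, fun hcon => ?_, ht, hβ, hαβ, ?_⟩
    · have := congrFun hcon ⟨0, hn⟩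
      simp at this
    · rw [transitionMatrix_mulVec_single_eq_iff R hR]
      intro y
      rw [h _ (binaryWeight_le y), binaryChar_not]
      push_cast
      ring

end

theorem proposition4p6 (n : ℕ) (R : Finset ℕ) (hR : ∀ r ∈ R, 0 < r ∧ r ≤ n)
    (hX : hammingUnion n R ≠ hammingGraph n n) (k : ℕ) (ζ : ℝ)
    (ε : ℤ) (hε : ε = 1 ∨ ε = -1) :
    HasPhasedRevival (hammingUnion n R) ζ (Real.cos (Real.pi / 4))
        ((ε : ℂ) * (Complex.I * (Real.sin (Real.pi / 4) : ℂ))) (Real.pi / 2 ^ k) ↔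
      (((∑ r ∈ R, intBinom (n - 1) (r - 1) : ℤ) : ℚ)
          ≡ -(ε : ℚ) * (2 : ℚ) ^ ((k : ℤ) - 2) [PMOD ((2 : ℚ) ^ k)]) ∧
      (∀ j : ℕ, 1 ≤ j → j ≤ k - 1 →
        ∑ r ∈ R, intBinom (n - 1 - j) (r - j) ≡ 0 [ZMOD 2 ^ (k - j)]) ∧
      (ζ + ((∑ r ∈ R, intBinom n r : ℤ) : ℝ) * Real.pi / 2 ^ k
          ≡ -(ε : ℝ) * (Real.pi / 4) [PMOD (2 * Real.pi)]) := by
  have hn : 0 < n := by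
    -- On a single vertex both graphs are edgeless, contradicting `hX`.
    rcases n.eq_zero_or_pos with rfl | h
    · refine absurd ?_ hX
      ext x y
      exact iff_of_false (fun h => h.ne (Subsingleton.elim _ _))
        fun h => h.ne (Subsingleton.elim _ _)
    · exact h
  have hsin : 0 < Real.sin (Real.pi / 4) := by rw [Real.sin_pi_div_four]; positivity
  have hε0 : (ε : ℂ) ≠ 0 := by rcases hε with rfl | rfl <;> simp
  have hεn : ‖(ε : ℂ)‖ = 1 := by rcases hε with rfl | rfl <;> simp
  have hexp : ‖Complex.exp (Complex.I * (ζ : ℂ))‖ = 1 := by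
    rw [mul_comm, Complex.norm_exp_ofReal_mul_I]
  rw [HasPhasedRevival, hasRevival_hammingUnion_iff hn R (fun r hr => (hR r hr).1) _
    (by positivity), ← phases_iff_congruences n hn R k ζ ε hε]
  · exact forall₂_congr fun s _ => phase_eq_iff k ζ ε hε s _
  · refine mul_ne_zero (Complex.exp_ne_zero _) (mul_ne_zero hε0 (mul_ne_zero Complex.I_ne_zero ?_))
    exact_mod_cast hsin.ne'
  · rw [norm_mul, norm_mul, norm_mul, norm_mul, hexp, hεn, Complex.norm_I, Complex.norm_real,
      Complex.norm_real, one_mul, one_mul, one_mul, one_mul, Real.norm_eq_abs, Real.norm_eq_abs,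
      sq_abs, sq_abs, Real.cos_sq_add_sin_sq]
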